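/- \textbf{Protocols.} Let the scalars be $\mathbb{R}$ or $\mathbb{C}$. An $\mathsf{R2}^*$ protocol sharing one EPR pair, on inputs $x,y\in\{-1,1\}^n$, is the following. Alice and Bob hold one qubit each of the state $|\Phi^+\rangle\langle\Phi^+|$, where $|\Phi^+\rangle=\tfrac{1}{\sqrt2}(|0\rangle_A|0\rangle_B+|1\rangle_A|1\rangle_B)$, together with private memories of arbitrary finite numbers $a,b$ of qubits, initially in the states $|0^a\rangle$ and $|0^b\rangle$. They exchange classical bits in $\{-1,1\}$. At each point the transcript so far determines whether the communication has ended and, if not, who speaks next. The speaker performs on her or his own qubits a quantum measurement with outcomes in $\{-1,1\}$, which depends only on the speaker's own input and on the transcript so far, and sends the outcome as one bit. (A measurement is given by operators $K_{s,i}$ with $s\in\{-1,1\}$, $1\le i\le r$, and $\sum_{s,i}K_{s,i}^\dagger K_{s,i}=\mathbb{I}$; outcome $s$ has probability $\mathrm{Tr}\big(\sum_i K_{s,i}\rho K_{s,i}^\dagger\big)$ and leaves the state proportional to $\sum_i K_{s,i}\rho K_{s,i}^\dagger$.) When the communication has ended, Alice outputs the outcome in $\{-1,1\}$ of a measurement of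 her qubits that depends on $x$ and the transcript. The protocol has cost at most $c$ if every transcript has at most $c$ bits, and $C(x,y)\in[-1,1]$ denotes its expected output on inputs $x,y$. \textbf{XOR-fiber and Fourier mass.} The XOR-fiber of $C$ is $H(z)=\mathbb{E}_{x\sim\{-1,1\}^n}[C(x,x\odot z)]$ for $z\in\{-1,1\}^n$, where $\odot$ is the point-wise product. For $f:\{-1,1\}^n\to\mathbb{R}$ let $\widehat f(S)=\mathbb{E}_{x\sim\{-1,1\}^n}\big[f(x)\prod_{i\in S}x_i\big]$ and $L_{1,\ell}(f)=\sum_{S\subseteq[n],\,|S|=\ell}|\widehat f(S)|$. \textbf{Lemma.} There are absolute constants $A,B$ such that for all natural numbers $n,c,\ell$ and every $\mathsf{R2}^*$ protocol $C$ of cost at most $c$ on inputs in $\{-1,1\}^n$ in which the players share one EPR pair (with private memories of any size), the XOR-fiber $H$ of $C$ satisfies \[ L_{1,\ell}(H)\;\le\; A\cdot 2^{B\ell}\;+\;A\cdot 2^{B\ell}\cdot\Big(\frac{c}{\ell}\Big)^{\ell}, \] where $(c/\ell)^\ell$ is read as $1$ for $\ell=0$. That is, $L_{1,\ell}(H)\le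 O_\ell(1)+O_\ell((c/\ell)^\ell)$, where $O_\ell(t)$ stands for $O(t\cdot 2^{O(\ell)})$. -/

import Mathlib

open scoped BigOperators Kronecker Matrix

noncomputable section

namespace R2Star

/-! ### Two-way protocols with shared entanglement and classical messages

The sign set `{-1, 1}` is `ℤˣ`; the scalars `𝕜` are `ℝ` or `ℂ`. -/

/-- Labels of the computational basis of an `m`-qubit register. -/
abbrev Reg (m : ℕ) : Type := Fin m → Fin 2

/-- Labels of the basis of a player's qubits: one qubit of the shared two-qubit state, together
with a private memory of `m` qubits. -/
abbrev Local (m : ℕ) : Type := Fin 2 × Reg m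

/-- A quantum measurement with outcomes in `{-1, 1}`, given by operators `kraus s i` with
`∑ s, ∑ i, (kraus s i)ᴴ * kraus s i = 1`. On outcome `s`, the state `ρ` becomes, up to
normalisation, `∑ i, kraus s i * ρ * (kraus s i)ᴴ`, whose trace is the probability of `s`.
The case `r = 1` is a measurement with one measurement operator per outcome; larger `r` also
allows local channels, discarding of qubits and private coins. -/
structure Measurement (𝕜 : Type*) [RCLike 𝕜] (ι : Type*) [Fintype ι] [DecidableEq ι] where
  r : ℕ
  kraus : ℤˣ → Fin r → Matrix ι ι 𝕜
  complete : ∑ s : ℤˣ, ∑ i : Fin r, (kraus s i)ᴴ * kraus s i = 1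

section

variable {𝕜 : Type*} [RCLike 𝕜] {ι κ : Type*} [Fintype ι] [DecidableEq ι] [Fintype κ]
  [DecidableEq κ]

/-- The unnormalised joint state after Alice measures her part and obtains `s`. -/
def Measurement.onAlice (M : Measurement 𝕜 ι) (s : ℤˣ) (ρ : Matrix (ι × κ) (ι × κ) 𝕜) :
    Matrix (ι × κ) (ι × κ) 𝕜 :=
  ∑ i : Fin M.r, (M.kraus s i ⊗ₖ (1 : Matrix κ κ 𝕜)) * ρ * (M.kraus s i ⊗ₖ (1 : Matrix κ κ 𝕜))ᴴ

/-- The unnormalised joint state after Bob measures his part and obtains `s`. -/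
def Measurement.onBob (M : Measurement 𝕜 κ) (s : ℤˣ) (ρ : Matrix (ι × κ) (ι × κ) 𝕜) :
    Matrix (ι × κ) (ι × κ) 𝕜 :=
  ∑ i : Fin M.r, ((1 : Matrix ι ι 𝕜) ⊗ₖ M.kraus s i) * ρ * ((1 : Matrix ι ι 𝕜) ⊗ₖ M.kraus s i)ᴴ

end

/-- Two-way protocols with classical messages on inputs `x, y ∈ {-1, 1} ^ n`, where Alice and Bob
hold one qubit each of a shared state and private memories of `a` and `b` qubits.
A protocol is a tree whose nodes are the possible transcripts: at a node `alice M P`, Alice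
performs the measurement `M x` on her qubits, sends the outcome `s` as one bit, and the players
go on with `P s`; similarly for `bob`. At a leaf the communication has ended, and Alice obtains
the output as the outcome of a last measurement of her qubits. (A predicate of the transcript is
the special case where this measurement has a fixed outcome.) -/
inductive Protocol (𝕜 : Type*) [RCLike 𝕜] (n a b : ℕ)
  | output (M : (Fin n → ℤˣ) → Measurement 𝕜 (Local a)) : Protocol 𝕜 n a b
  | alice (M : (Fin n → ℤˣ) → Measurement 𝕜 (Local a)) (P : ℤˣ → Protocol 𝕜 n a b) :
      Protocol 𝕜 n a b
  | bob (M : (Fin n → ℤˣ) → Measurement 𝕜 (Local b)) (P : ℤˣ → Protocol 𝕜 n a b) :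
      Protocol 𝕜 n a b

namespace Protocol

variable {𝕜 : Type*} [RCLike 𝕜] {n a b : ℕ}

/-- The maximal length of a transcript, in bits. -/
def cost : Protocol 𝕜 n a b → ℕ
  | output _ => 0
  | alice _ P => max (P 1).cost (P (-1)).cost + 1
  | bob _ P => max (P 1).cost (P (-1)).cost + 1

/-- The sum over all transcripts and outputs `s` of `s` times the probability of that transcript
and output, when the protocol is run on inputs `x, y` from the (unnormalised) joint state `ρ`. -/
def run (x y : Fin n → ℤˣ) :
    Protocol 𝕜 n a b → Matrix (Local a × Local b) (Local a × Local b) 𝕜 → ℝ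
  | output M, ρ => ∑ s : ℤˣ, ((s : ℤ) : ℝ) * RCLike.re ((M x).onAlice s ρ).trace
  | alice M P, ρ => ∑ s : ℤˣ, run x y (P s) ((M x).onAlice s ρ)
  | bob M P, ρ => ∑ s : ℤˣ, run x y (P s) ((M y).onBob s ρ)

end Protocol

/-- The pure state `|0…0⟩⟨0…0|` of an `m`-qubit register. -/
def zeroState (𝕜 : Type*) [RCLike 𝕜] (m : ℕ) : Matrix (Reg m) (Reg m) 𝕜 :=
  Matrix.single 0 0 1

/-- The unit vector `(|0⟩|0⟩ + |1⟩|1⟩) / √2`; the first qubit is Alice's, the second Bob's. -/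
def eprVector (𝕜 : Type*) [RCLike 𝕜] : Fin 2 × Fin 2 → 𝕜 :=
  fun p => if p.1 = p.2 then ((1 / √2 : ℝ) : 𝕜) else 0

/-- The EPR state `|Φ⁺⟩⟨Φ⁺|`. -/
def eprState (𝕜 : Type*) [RCLike 𝕜] : Matrix (Fin 2 × Fin 2) (Fin 2 × Fin 2) 𝕜 :=
  Matrix.vecMulVec (eprVector 𝕜) (star (eprVector 𝕜))

/-- The initial joint state `ρ ⊗ |0…0⟩⟨0…0|_A ⊗ |0…0⟩⟨0…0|_B`, with the tensor factors arranged
so that Alice's qubits come first. -/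
def initialState {𝕜 : Type*} [RCLike 𝕜] (a b : ℕ) (ρ : Matrix (Fin 2 × Fin 2) (Fin 2 × Fin 2) 𝕜) :
    Matrix (Local a × Local b) (Local a × Local b) 𝕜 :=
  (ρ ⊗ₖ (zeroState 𝕜 a ⊗ₖ zeroState 𝕜 b)).submatrix
    (Equiv.prodProdProdComm (Fin 2) (Reg a) (Fin 2) (Reg b))
    (Equiv.prodProdProdComm (Fin 2) (Reg a) (Fin 2) (Reg b))

/-- The function `C(x, y)`: the expected output on inputs `x, y` when the players share one EPR
pair. -/
def Protocol.expectedOutput {𝕜 : Type*} [RCLike 𝕜] {n a b : ℕ} (P : Protocol 𝕜 n a b)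
    (x y : Fin n → ℤˣ) : ℝ :=
  P.run x y (initialState a b (eprState 𝕜))

/-! ### XOR-fibers and Fourier coefficients -/

/-- The XOR-fiber `H(z) = 𝔼 x, C(x, x ⊙ z)`. -/
def xorFiber {n : ℕ} (C : (Fin n → ℤˣ) → (Fin n → ℤˣ) → ℝ) (z : Fin n → ℤˣ) : ℝ :=
  𝔼 x : Fin n → ℤˣ, C x (x * z)

/-- The Fourier coefficient `𝔼 x, f(x) χ_S(x)`, where `χ_S(x) = ∏ i ∈ S, x i`. -/
def fourierCoeff {n : ℕ} (f : (Fin n → ℤˣ) → ℝ) (S : Finset (Fin n)) : ℝ :=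
  𝔼 x : Fin n → ℤˣ, f x * ∏ i ∈ S, ((x i : ℤ) : ℝ)

/-- The level-`l` Fourier mass `L_{1,l}(f)`: the sum of `|f̂(S)|` over all `S` of size `l`. -/
def levelMass {n : ℕ} (l : ℕ) (f : (Fin n → ℤˣ) → ℝ) : ℝ :=
  ∑ S ∈ Finset.powersetCard l (Finset.univ : Finset (Fin n)), |fourierCoeff f S|

end R2Star

end

noncomputable section

namespace R2Star

/-! ### A hypercontractive inequality on the cube -/

theorem choose_two_mul_le (k j : ℕ) : (2 * k).choose (2 * j) ≤ (2 * k) ^ j * k.choose j := by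
  induction j with
  | zero => simp
  | succ j ih =>
    have h1 := Nat.choose_succ_right_eq (2 * k) (2 * j)
    have h2 := Nat.choose_succ_right_eq (2 * k) (2 * j + 1)
    have h3 := Nat.choose_succ_right_eq k j
    rw [show 2 * k - 2 * j = 2 * (k - j) by omega] at h1
    refine le_of_mul_le_mul_right (a := (2 * j + 1 + 1) * (2 * j + 1)) ?_
      (Nat.mul_pos (Nat.succ_pos _) (Nat.succ_pos _))
    calc (2 * k).choose (2 * (j + 1)) * ((2 * j + 1 + 1) * (2 * j + 1))
        = ((2 * k).choose (2 * j + 1 + 1) * (2 * j + 1 + 1)) * (2 * j + 1) := by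
          rw [← mul_assoc]; rfl
      _ = ((2 * k).choose (2 * j + 1) * (2 * j + 1)) * (2 * k - (2 * j + 1)) := by
          rw [h2]; ring
      _ = (2 * k).choose (2 * j) * (2 * (k - j)) * (2 * k - (2 * j + 1)) := by rw [h1]
      _ ≤ ((2 * k) ^ j * k.choose j) * (2 * (k - j)) * (2 * k) := by
          exact Nat.mul_le_mul (Nat.mul_le_mul_right _ ih) (Nat.sub_le _ _)
      _ = (2 * k) ^ (j + 1) * 2 * (k.choose j * (k - j)) := by ring
      _ = (2 * k) ^ (j + 1) * k.choose (j + 1) * ((2 * j + 1 + 1) * 1) := by rw [← h3]; ring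
      _ ≤ (2 * k) ^ (j + 1) * k.choose (j + 1) * ((2 * j + 1 + 1) * (2 * j + 1)) := by
          gcongr
          omega

theorem sum_range_of_odd_eq_zero {M : Type*} [AddCommMonoid M] (f : ℕ → M)
    (hf : ∀ j, f (2 * j + 1) = 0) (k : ℕ) :
    ∑ m ∈ Finset.range (2 * k + 1), f m = ∑ j ∈ Finset.range (k + 1), f (2 * j) := by
  induction k with
  | zero => simp
  | succ k ih =>
    rw [show 2 * (k + 1) + 1 = 2 * k + 1 + 1 + 1 by ring, Finset.sum_range_succ,
      Finset.sum_range_succ, ih, hf, add_zero, Finset.sum_range_succ _ (k + 1)]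
    rfl

theorem add_pow_add_sub_pow_le (a b : ℝ) (k : ℕ) :
    (a + b) ^ (2 * k) + (a - b) ^ (2 * k) ≤ 2 * (a ^ 2 + 2 * k * b ^ 2) ^ k := by
  have h : (a + b) ^ (2 * k) + (a - b) ^ (2 * k) = ∑ m ∈ Finset.range (2 * k + 1),
      (b ^ m + (-b) ^ m) * (a ^ (2 * k - m) * (2 * k).choose m) := by
    rw [add_comm a b, sub_eq_neg_add, add_pow, add_pow, ← Finset.sum_add_distrib]
    exact Finset.sum_congr rfl fun m _ => by ring
  rw [h, sum_range_of_odd_eq_zero _ fun j => by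
    rw [Odd.neg_pow (odd_two_mul_add_one j), add_neg_cancel, zero_mul], add_comm (a ^ 2),
    add_pow, Finset.mul_sum]
  refine Finset.sum_le_sum fun j _ => ?_
  have hc : ((2 * k).choose (2 * j) : ℝ) ≤ (2 * k : ℝ) ^ j * k.choose j := by
    exact_mod_cast choose_two_mul_le k j
  rw [Even.neg_pow (even_two_mul j), ← two_mul, pow_mul b, ← Nat.mul_sub, pow_mul a, mul_pow]
  calc 2 * (b ^ 2) ^ j * ((a ^ 2) ^ (k - j) * (2 * k).choose (2 * j))
      ≤ 2 * (b ^ 2) ^ j * ((a ^ 2) ^ (k - j) * ((2 * k : ℝ) ^ j * k.choose j)) := by gcongr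
    _ = _ := by ring

theorem sum_add_pow_le {ι : Type*} (s : Finset ι) {u v : ι → ℝ} (hu : ∀ i, 0 ≤ u i)
    (hv : ∀ i, 0 ≤ v i) {N A B : ℝ} (hN : 0 ≤ N) (hA : 0 ≤ A) (hB : 0 ≤ B) {k : ℕ} (hk : k ≠ 0)
    (h1 : ∑ i ∈ s, u i ^ k ≤ N * A ^ k) (h2 : ∑ i ∈ s, v i ^ k ≤ N * B ^ k) :
    ∑ i ∈ s, (u i + v i) ^ k ≤ N * (A + B) ^ k := by
  have hk0 : (k : ℝ) ≠ 0 := by exact_mod_cast hk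
  have key := Real.Lp_add_le_of_nonneg s (f := u) (g := v) (p := k)
    (by exact_mod_cast Nat.one_le_iff_ne_zero.2 hk) (fun i _ => hu i) fun i _ => hv i
  simp only [Real.rpow_natCast] at key
  have root : ∀ {w : ι → ℝ} {D : ℝ}, (∀ i, 0 ≤ w i) → 0 ≤ D → ∑ i ∈ s, w i ^ k ≤ N * D ^ k →
      (∑ i ∈ s, w i ^ k) ^ (1 / (k : ℝ)) ≤ N ^ (1 / (k : ℝ)) * D := by
    intro w D hw hD h
    calc (∑ i ∈ s, w i ^ k) ^ (1 / (k : ℝ)) ≤ (N * D ^ k) ^ (1 / (k : ℝ)) :=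
          Real.rpow_le_rpow (Finset.sum_nonneg fun i _ => pow_nonneg (hw i) _) h (by positivity)
      _ = N ^ (1 / (k : ℝ)) * D := by
          rw [Real.mul_rpow hN (by positivity), one_div, Real.pow_rpow_inv_natCast hD hk]
  have h3 := key.trans (add_le_add (root hu hA h1) (root hv hB h2))
  have h0 : 0 ≤ ∑ i ∈ s, (u i + v i) ^ k :=
    Finset.sum_nonneg fun i _ => pow_nonneg (add_nonneg (hu i) (hv i)) _
  have h4 := pow_le_pow_left₀ (Real.rpow_nonneg h0 _) h3 k
  rwa [one_div, Real.rpow_inv_natCast_pow h0 hk, ← mul_add, mul_pow,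
    Real.rpow_inv_natCast_pow hN hk] at h4

/-- The character `χ_S`. -/
def character {n : ℕ} (S : Finset (Fin n)) (x : Fin n → ℤˣ) : ℝ := ∏ i ∈ S, ((x i : ℤ) : ℝ)

theorem character_mul {n : ℕ} (S : Finset (Fin n)) (x y : Fin n → ℤˣ) :
    character S (x * y) = character S x * character S y := by
  simp [character, Finset.prod_mul_distrib]

/-- Negation of the `i`-th coordinate. -/
def flip {n : ℕ} (i : Fin n) : (Fin n → ℤˣ) ≃ (Fin n → ℤˣ) :=
  Equiv.mulLeft (Pi.mulSingle i (-1))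

theorem character_flip {n : ℕ} {S : Finset (Fin n)} {i : Fin n} (hi : i ∉ S) (x : Fin n → ℤˣ) :
    character S (flip i x) = character S x := by
  refine Finset.prod_congr rfl fun j hj => ?_
  have : j ≠ i := fun h => hi (h ▸ hj)
  simp [flip, Pi.mulSingle_eq_of_ne this]

theorem sum_sum_character_pow_le {n k : ℕ} (hk : k ≠ 0) (T : Finset (Fin n)) :
    ∀ c : Finset (Fin n) → ℝ,
      ∑ x : Fin n → ℤˣ, (∑ S ∈ T.powerset, c S * character S x) ^ (2 * k) ≤
        (Fintype.card (Fin n → ℤˣ) : ℝ) * (∑ S ∈ T.powerset, (2 * k : ℝ) ^ S.card * c S ^ 2) ^ k := by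
  induction T using Finset.induction_on with
  | empty =>
    intro c
    simp [character, pow_mul]
  | insert i T hi ih =>
    intro c
    set p : (Fin n → ℤˣ) → ℝ := fun x => ∑ S ∈ T.powerset, c S * character S x with hp
    set q : (Fin n → ℤˣ) → ℝ := fun x => ∑ S ∈ T.powerset, c (insert i S) * character S x with hq
    have hT : ∀ S ∈ T.powerset, i ∉ S := fun S hS h => hi (Finset.mem_powerset.1 hS h)
    have hpf : ∀ x, p (flip i x) = p x := fun x =>
      Finset.sum_congr rfl fun S hS => by rw [character_flip (hT S hS)]
    have hqf : ∀ x, q (flip i x) = q x := fun x =>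
      Finset.sum_congr rfl fun S hS => by rw [character_flip (hT S hS)]
    have hsplit : ∀ x, ∑ S ∈ (insert i T).powerset, c S * character S x =
        p x + ((x i : ℤ) : ℝ) * q x := by
      intro x
      rw [Finset.sum_powerset_insert hi, hq, Finset.mul_sum]
      refine congrArg (p x + ·) (Finset.sum_congr rfl fun S hS => ?_)
      rw [character, Finset.prod_insert (hT S hS), character]
      ring
    have hflip : ∀ x : Fin n → ℤˣ, ((flip i x i : ℤ) : ℝ) = -((x i : ℤ) : ℝ) := by
      intro x
      simp [flip]
    have hpt : ∀ x : Fin n → ℤˣ, (p x + ((x i : ℤ) : ℝ) * q x) ^ (2 * k) +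
        (p x - ((x i : ℤ) : ℝ) * q x) ^ (2 * k) ≤ 2 * (p x ^ 2 + 2 * k * q x ^ 2) ^ k := by
      intro x
      refine (add_pow_add_sub_pow_le _ _ k).trans_eq ?_
      rcases Int.units_eq_one_or (x i) with h | h <;> simp [h]
    have hsym : ∑ x, (p x + ((x i : ℤ) : ℝ) * q x) ^ (2 * k) =
        ∑ x, (p x - ((x i : ℤ) : ℝ) * q x) ^ (2 * k) := by
      refine Fintype.sum_equiv (flip i) _ _ fun x => ?_
      rw [hpf, hqf, hflip]
      ring
    have hle : ∑ x, (p x + ((x i : ℤ) : ℝ) * q x) ^ (2 * k) ≤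
        ∑ x, (p x ^ 2 + 2 * k * q x ^ 2) ^ k := by
      have := Finset.sum_le_sum fun x (_ : x ∈ Finset.univ) => hpt x
      rw [Finset.sum_add_distrib, ← hsym, ← Finset.mul_sum] at this
      linarith
    simp only [hsplit]
    refine hle.trans ?_
    rw [Finset.sum_powerset_insert hi]
    have hB : ∑ S ∈ T.powerset, (2 * k : ℝ) ^ (insert i S).card * c (insert i S) ^ 2 =
        2 * k * ∑ S ∈ T.powerset, (2 * k : ℝ) ^ S.card * c (insert i S) ^ 2 := by
      rw [Finset.mul_sum]
      refine Finset.sum_congr rfl fun S hS => ?_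
      rw [Finset.card_insert_of_notMem (hT S hS)]
      ring
    rw [hB]
    refine sum_add_pow_le _ (fun x => by positivity) (fun x => by positivity) (by positivity)
      (Finset.sum_nonneg fun S _ => by positivity)
      (mul_nonneg (by positivity) (Finset.sum_nonneg fun S _ => by positivity)) hk ?_ ?_
    · simpa only [pow_mul] using ih c
    · have := mul_le_mul_of_nonneg_left (ih fun S => c (insert i S))
        (by positivity : (0 : ℝ) ≤ (2 * k) ^ k)
      simp only [mul_pow (2 * k : ℝ), ← Finset.mul_sum, ← pow_mul]
      exact this.trans_eq (by rw [mul_left_comm])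

/-! ### The level-`l` inequality -/

theorem fourierCoeff_eq {n : ℕ} (f : (Fin n → ℤˣ) → ℝ) (S : Finset (Fin n)) :
    fourierCoeff f S = 𝔼 x, f x * character S x := rfl

/-- The level-`l` Fourier weight: the sum of `f̂(S)²` over all `S` of size `l`. -/
def levelWeight {n : ℕ} (l : ℕ) (f : (Fin n → ℤˣ) → ℝ) : ℝ :=
  ∑ S ∈ Finset.powersetCard l (Finset.univ : Finset (Fin n)), fourierCoeff f S ^ 2

theorem levelWeight_nonneg {n : ℕ} (l : ℕ) (f : (Fin n → ℤˣ) → ℝ) : 0 ≤ levelWeight l f :=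
  Finset.sum_nonneg fun _ _ => sq_nonneg _

theorem expect_levelPart_pow_le {n k : ℕ} (hk : k ≠ 0) (l : ℕ) (f : (Fin n → ℤˣ) → ℝ) :
    𝔼 x, (∑ S ∈ Finset.powersetCard l (Finset.univ : Finset (Fin n)),
      fourierCoeff f S * character S x) ^ (2 * k) ≤ ((2 * k : ℝ) ^ l * levelWeight l f) ^ k := by
  have h := sum_sum_character_pow_le hk (Finset.univ : Finset (Fin n))
    fun S => if S.card = l then fourierCoeff f S else 0
  have e : Finset.powersetCard l (Finset.univ : Finset (Fin n)) =
      (Finset.univ : Finset (Fin n)).powerset.filter (fun S => S.card = l) := by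
    ext S; simp [Finset.mem_powersetCard]
  rw [Fintype.expect_eq_sum_div_card, div_le_iff₀' (by exact_mod_cast Fintype.card_pos)]
  have h1 : ∀ x, ∑ S ∈ Finset.univ.powerset, (if S.card = l then fourierCoeff f S else 0) *
      character S x = ∑ S ∈ Finset.powersetCard l Finset.univ, fourierCoeff f S * character S x := by
    intro x
    rw [e, Finset.sum_filter]
    exact Finset.sum_congr rfl fun S _ => by split_ifs <;> simp
  have h2 : ∑ S ∈ Finset.univ.powerset, (2 * k : ℝ) ^ S.card *
      (if S.card = l then fourierCoeff f S else 0) ^ 2 = (2 * k : ℝ) ^ l * levelWeight l f := by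
    rw [levelWeight, e, Finset.sum_filter, Finset.mul_sum]
    refine Finset.sum_congr rfl fun S _ => ?_
    split_ifs with hS
    · rw [hS]
    · simp
  simpa only [h1, h2] using h

theorem expect_mul_pow_le {X : Type*} [Fintype X] [Nonempty X] {w z : X → ℝ} (hw : ∀ x, 0 ≤ w x)
    (hz : ∀ x, 0 ≤ z x) {m : ℕ} (hm : m ≠ 0) :
    (𝔼 x, w x * z x) ^ m ≤ (𝔼 x, w x) ^ (m - 1) * 𝔼 x, w x * z x ^ m := by
  obtain ⟨m, rfl⟩ := Nat.exists_eq_succ_of_ne_zero hm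
  have hc : (0 : ℝ) < Fintype.card X := by exact_mod_cast Fintype.card_pos
  simp only [Fintype.expect_eq_sum_div_card]
  rw [div_pow, div_pow, div_mul_div_comm, Nat.succ_sub_one, ← pow_succ]
  refine div_le_div_of_nonneg_right ?_ (by positivity)
  set W := ∑ x, w x with hW
  have hW0 : 0 ≤ W := Finset.sum_nonneg fun x _ => hw x
  rcases hW0.eq_or_lt with h | h
  · have : ∀ x, w x = 0 := fun x =>
      (Finset.sum_eq_zero_iff_of_nonneg fun x _ => hw x).1 (hW ▸ h.symm) x (Finset.mem_univ x)
    simp [this]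
  · have := Real.pow_arith_mean_le_arith_mean_pow Finset.univ (fun x => w x / W) z
      (fun x _ => div_nonneg (hw x) hW0) (by rw [← Finset.sum_div, ← hW, div_self h.ne'])
      (fun x _ => hz x) (m + 1)
    simp only [div_mul_eq_mul_div, ← Finset.sum_div] at this
    rw [div_pow, div_le_div_iff₀ (by positivity) h] at this
    refine le_of_mul_le_mul_right (this.trans_eq ?_) h
    rw [pow_succ]
    ring

theorem levelWeight_pow_le {n k : ℕ} (hk : k ≠ 0) (l : ℕ) {f g : (Fin n → ℤˣ) → ℝ}
    (hfg : ∀ x, |f x| ≤ g x) (hg : ∀ x, g x ≤ 1) :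
    levelWeight l f ^ k ≤ (𝔼 x, g x) ^ (2 * k - 1) * ((2 * k : ℝ) ^ l) ^ k := by
  set p : (Fin n → ℤˣ) → ℝ := fun x =>
    ∑ S ∈ Finset.powersetCard l (Finset.univ : Finset (Fin n)), fourierCoeff f S * character S x
    with hp
  have hg0 : ∀ x, 0 ≤ g x := fun x => (abs_nonneg _).trans (hfg x)
  have hW0 := levelWeight_nonneg l f
  have hmu : 0 ≤ 𝔼 x, g x := Finset.expect_nonneg fun x _ => hg0 x
  have hW : levelWeight l f = 𝔼 x, f x * p x := by
    simp only [hp, Finset.mul_sum]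
    rw [Finset.expect_sum_comm]
    refine Finset.sum_congr rfl fun S _ => ?_
    rw [sq]
    nth_rw 2 [fourierCoeff_eq]
    rw [Finset.mul_expect]
    exact Finset.expect_congr rfl fun x _ => by ring
  have h1 : levelWeight l f ≤ 𝔼 x, g x * |p x| := by
    rw [hW]
    refine Finset.expect_le_expect fun x _ => (le_abs_self _).trans ?_
    rw [abs_mul]
    exact mul_le_mul_of_nonneg_right (hfg x) (abs_nonneg _)
  have h2 : levelWeight l f ^ (2 * k) ≤
      (𝔼 x, g x) ^ (2 * k - 1) * ((2 * k : ℝ) ^ l * levelWeight l f) ^ k :=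
    calc levelWeight l f ^ (2 * k) ≤ (𝔼 x, g x * |p x|) ^ (2 * k) := pow_le_pow_left₀ hW0 h1 _
      _ ≤ (𝔼 x, g x) ^ (2 * k - 1) * 𝔼 x, g x * |p x| ^ (2 * k) :=
          expect_mul_pow_le hg0 (fun x => abs_nonneg _) (by omega)
      _ ≤ (𝔼 x, g x) ^ (2 * k - 1) * 𝔼 x, p x ^ (2 * k) := by
          refine mul_le_mul_of_nonneg_left (Finset.expect_le_expect fun x _ => ?_) (by positivity)
          rw [Even.pow_abs (even_two_mul k)]
          exact mul_le_of_le_one_left (Even.pow_nonneg (even_two_mul k) _) (hg x)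
      _ ≤ _ := mul_le_mul_of_nonneg_left (expect_levelPart_pow_le hk l f) (by positivity)
  rcases hW0.eq_or_lt with h | h
  · rw [← h, zero_pow hk]
    positivity
  · refine le_of_mul_le_mul_right ?_ (pow_pos h k)
    calc levelWeight l f ^ k * levelWeight l f ^ k = levelWeight l f ^ (2 * k) := by ring
      _ ≤ _ := h2
      _ = _ := by rw [mul_pow, mul_assoc]

theorem sum_abs_fourierCoeff_mul_pow_le {n k : ℕ} (hk : k ≠ 0) (l : ℕ)
    {f g u v : (Fin n → ℤˣ) → ℝ} (hf : ∀ x, |f x| ≤ u x) (hg : ∀ x, |g x| ≤ v x)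
    (hu : ∀ x, u x ≤ 1) (hv : ∀ x, v x ≤ 1) :
    (∑ S ∈ Finset.powersetCard l (Finset.univ : Finset (Fin n)),
      |fourierCoeff f S| * |fourierCoeff g S|) ^ (2 * k) ≤
        ((𝔼 x, u x) * 𝔼 y, v y) ^ (2 * k - 1) * ((2 * k : ℝ) ^ l) ^ (2 * k) := by
  have h := Finset.sum_mul_sq_le_sq_mul_sq
    (Finset.powersetCard l (Finset.univ : Finset (Fin n)))
    (fun S => |fourierCoeff f S|) fun S => |fourierCoeff g S|
  simp only [sq_abs] at h
  have hu0 : 0 ≤ 𝔼 x, u x := Finset.expect_nonneg fun x _ => (abs_nonneg _).trans (hf x)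
  calc _ ≤ (levelWeight l f * levelWeight l g) ^ k := by
        rw [pow_mul]
        exact pow_le_pow_left₀ (sq_nonneg _) h k
    _ = levelWeight l f ^ k * levelWeight l g ^ k := mul_pow _ _ _
    _ ≤ ((𝔼 x, u x) ^ (2 * k - 1) * ((2 * k : ℝ) ^ l) ^ k) *
        ((𝔼 x, v x) ^ (2 * k - 1) * ((2 * k : ℝ) ^ l) ^ k) :=
        mul_le_mul (levelWeight_pow_le hk l hf hu) (levelWeight_pow_le hk l hg hv)
          (pow_nonneg (levelWeight_nonneg l g) k) (by positivity)
    _ = _ := by rw [mul_pow]; ring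

/-! ### Sums of products -/

theorem fourierCoeff_xorFiber {n : ℕ} (C : (Fin n → ℤˣ) → (Fin n → ℤˣ) → ℝ)
    (S : Finset (Fin n)) :
    fourierCoeff (xorFiber C) S = 𝔼 x, 𝔼 y, C x y * (character S x * character S y) := by
  simp only [fourierCoeff_eq, xorFiber, Finset.expect_mul]
  rw [Finset.expect_comm]
  refine Finset.expect_congr rfl fun x _ => Fintype.expect_equiv (Equiv.mulLeft x) _ _ fun z => ?_
  have hx : x * x = 1 := funext fun i => by simp
  rw [← character_mul, Equiv.coe_mulLeft, ← mul_assoc, hx, one_mul]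

/-- If `C(x, y) = ∑ t e, σ t e * f t e x * h t e y` with factors bounded by `u t ≤ 1` and `v t ≤ 1`
such that `∑ t, u t x * v t y = 1`, then the level-`l` mass of the XOR-fiber of `C` is bounded in
terms of the number of indices `t`. -/
theorem levelMass_xorFiber_le {n : ℕ} {ι κ : Type*} [Fintype ι] [Fintype κ] [Nonempty κ]
    {C : (Fin n → ℤˣ) → (Fin n → ℤˣ) → ℝ} (σ : ι → κ → ℝ) (f h : ι → κ → (Fin n → ℤˣ) → ℝ)
    (u v : ι → (Fin n → ℤˣ) → ℝ) {s D M : ℝ} {k l : ℕ} (hk : k ≠ 0) (hs : ∀ t e, |σ t e| ≤ s)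
    (hf : ∀ t e x, |f t e x| ≤ u t x) (hh : ∀ t e x, |h t e x| ≤ v t x)
    (hu : ∀ t x, u t x ≤ 1) (hv : ∀ t x, v t x ≤ 1)
    (huv : ∀ x y, ∑ t, u t x * v t y = 1)
    (hC : ∀ x y, C x y = ∑ t, ∑ e, σ t e * (f t e x * h t e y))
    (hD : D = (2 * k : ℝ) ^ l) (hM0 : 0 ≤ M) (hM : (Fintype.card ι : ℝ) ≤ M ^ (2 * k)) :
    levelMass l (xorFiber C) ≤ Fintype.card κ * s * (2 * (D * M)) := by
  have hcoeff : ∀ S, fourierCoeff (xorFiber C) S =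
      ∑ t, ∑ e, σ t e * (fourierCoeff (f t e) S * fourierCoeff (h t e) S) := by
    intro S
    simp only [fourierCoeff_xorFiber, hC, Finset.sum_mul, Finset.expect_sum_comm]
    refine Finset.sum_congr rfl fun t _ => Finset.sum_congr rfl fun e _ => ?_
    rw [fourierCoeff_eq, fourierCoeff_eq, Finset.expect_mul_expect, Finset.mul_expect]
    refine Finset.expect_congr rfl fun x _ => ?_
    rw [Finset.mul_expect]
    exact Finset.expect_congr rfl fun y _ => by ring
  set p : ι → ℝ := fun t => (𝔼 x, u t x) * 𝔼 y, v t y with hp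
  have hp0 : ∀ t, 0 ≤ p t := fun t =>
    mul_nonneg
      (Finset.expect_nonneg fun x _ => (abs_nonneg _).trans (hf t (Classical.arbitrary κ) x))
      (Finset.expect_nonneg fun x _ => (abs_nonneg _).trans (hh t (Classical.arbitrary κ) x))
  have hpsum : ∑ t, p t = 1 := by
    have h1 : ∀ t, p t = 𝔼 x, 𝔼 y, u t x * v t y := fun t => by
      simp only [hp, Finset.expect_mul_expect]
    simp only [h1]
    rw [← Finset.expect_sum_comm]
    simp only [← Finset.expect_sum_comm, huv]
    simp
  have hN : (0 : ℝ) < Fintype.card ι := by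
    have : Nonempty ι := not_isEmpty_iff.1 fun _ => by simp at hpsum
    exact_mod_cast Fintype.card_pos
  have hD0 : 0 ≤ D := by rw [hD]; positivity
  set N : ℝ := (Fintype.card ι : ℝ) with hNdef
  have hT : ∀ t e, ∑ S ∈ Finset.powersetCard l (Finset.univ : Finset (Fin n)),
      |fourierCoeff (f t e) S| * |fourierCoeff (h t e) S| ≤ D * M * (p t + 1 / N) := by
    intro t e
    have hpt := hp0 t
    refine le_of_pow_le_pow_left₀ (n := 2 * k) (by omega) (by positivity)
      ((sum_abs_fourierCoeff_mul_pow_le hk l (hf t e) (hh t e) (hu t) (hv t)).trans ?_)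
    rw [← hD]
    obtain ⟨m, hm⟩ : ∃ m, 2 * k = m + 1 := ⟨2 * k - 1, by omega⟩
    rw [hm] at hM ⊢
    calc p t ^ m * D ^ (m + 1) = D ^ (m + 1) * N * (p t ^ m * (1 / N)) := by field_simp
      _ ≤ D ^ (m + 1) * M ^ (m + 1) * ((p t + 1 / N) ^ m * (p t + 1 / N)) := by
          gcongr
          · exact le_add_of_nonneg_right (by positivity)
          · exact le_add_of_nonneg_left hpt
      _ = _ := by rw [mul_pow (D * M), mul_pow D M, pow_succ (p t + _)]
  calc levelMass l (xorFiber C)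
      ≤ ∑ S ∈ Finset.powersetCard l (Finset.univ : Finset (Fin n)), ∑ t, ∑ e,
          s * (|fourierCoeff (f t e) S| * |fourierCoeff (h t e) S|) := by
        refine Finset.sum_le_sum fun S _ => ?_
        rw [hcoeff]
        refine (Finset.abs_sum_le_sum_abs _ _).trans (Finset.sum_le_sum fun t _ =>
          (Finset.abs_sum_le_sum_abs _ _).trans (Finset.sum_le_sum fun e _ => ?_))
        rw [abs_mul, abs_mul]
        exact mul_le_mul_of_nonneg_right (hs t e) (by positivity)
    _ = ∑ t, ∑ e, s * ∑ S ∈ Finset.powersetCard l (Finset.univ : Finset (Fin n)),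
          |fourierCoeff (f t e) S| * |fourierCoeff (h t e) S| := by
        rw [Finset.sum_comm]
        refine Finset.sum_congr rfl fun t _ => ?_
        rw [Finset.sum_comm]
        exact Finset.sum_congr rfl fun e _ => (Finset.mul_sum _ _ _).symm
    _ ≤ ∑ t, ∑ _e : κ, s * (D * M * (p t + 1 / N)) :=
        Finset.sum_le_sum fun t _ => Finset.sum_le_sum fun e _ =>
          mul_le_mul_of_nonneg_left (hT t e) ((abs_nonneg _).trans (hs t e))
    _ = _ := by
        simp only [Finset.sum_const, Finset.card_univ, nsmul_eq_mul, ← Finset.mul_sum,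
          Finset.sum_add_distrib, hpsum]
        rw [← hNdef, mul_one_div_cancel hN.ne']
        ring

open scoped ComplexOrder MatrixOrder

/-! ### Protocols in the Heisenberg picture -/

section

variable {𝕜 : Type*} [RCLike 𝕜] {ι κ : Type*} [Fintype ι] [DecidableEq ι] [Fintype κ]
  [DecidableEq κ]

/-- The effect `∑ i, (kraus s i)ᴴ * E * kraus s i`: obtain `s`, then observe `E`. -/
def Measurement.dual (M : Measurement 𝕜 ι) (s : ℤˣ) (E : Matrix ι ι 𝕜) : Matrix ι ι 𝕜 :=
  ∑ i, (M.kraus s i)ᴴ * E * M.kraus s i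

theorem Measurement.sum_dual_one (M : Measurement 𝕜 ι) : ∑ s, M.dual s 1 = 1 := by
  simpa [Measurement.dual] using M.complete

theorem Measurement.posSemidef_dual (M : Measurement 𝕜 ι) (s : ℤˣ) {E : Matrix ι ι 𝕜}
    (hE : E.PosSemidef) : (M.dual s E).PosSemidef :=
  Matrix.posSemidef_sum _ fun _ _ => hE.conjTranspose_mul_mul_same _

theorem Measurement.posSemidef_one_sub_dual (M : Measurement 𝕜 ι) (s : ℤˣ) {E : Matrix ι ι 𝕜}
    (hE : (1 - E).PosSemidef) : (1 - M.dual s E).PosSemidef := by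
  have h : 1 - M.dual s E = M.dual s (1 - E) + ∑ s' ∈ Finset.univ.erase s, M.dual s' 1 := by
    have h1 : M.dual s (1 - E) = M.dual s 1 - M.dual s E := by
      simp [Measurement.dual, mul_sub, sub_mul]
    have h2 := Finset.add_sum_erase _ (fun s' => M.dual s' 1) (Finset.mem_univ s)
    rw [h1, sub_add_eq_add_sub, h2, M.sum_dual_one]
  rw [h]
  exact (M.posSemidef_dual s hE).add
    (Matrix.posSemidef_sum _ fun s' _ => M.posSemidef_dual s' Matrix.PosSemidef.one)

theorem Measurement.trace_kronecker_mul_onAlice (M : Measurement 𝕜 ι) (s : ℤˣ)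
    (E : Matrix ι ι 𝕜) (F : Matrix κ κ 𝕜) (ρ : Matrix (ι × κ) (ι × κ) 𝕜) :
    ((E ⊗ₖ F) * M.onAlice s ρ).trace = ((M.dual s E ⊗ₖ F) * ρ).trace := by
  simp only [Measurement.onAlice, Measurement.dual, Finset.mul_sum, Matrix.trace_sum]
  rw [show (∑ i, (M.kraus s i)ᴴ * E * M.kraus s i) ⊗ₖ F =
      ∑ i, ((M.kraus s i)ᴴ * E * M.kraus s i) ⊗ₖ F by
    ext; simp [Matrix.sum_apply, Finset.sum_mul], Finset.sum_mul, Matrix.trace_sum]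
  refine Finset.sum_congr rfl fun i _ => ?_
  have h : ((M.kraus s i)ᴴ * E * M.kraus s i) ⊗ₖ F =
      (M.kraus s i ⊗ₖ (1 : Matrix κ κ 𝕜))ᴴ * (E ⊗ₖ F) * (M.kraus s i ⊗ₖ (1 : Matrix κ κ 𝕜)) := by
    rw [Matrix.conjTranspose_kronecker, ← Matrix.mul_kronecker_mul, ← Matrix.mul_kronecker_mul]
    simp
  rw [h, ← mul_assoc, Matrix.trace_mul_comm]
  simp only [mul_assoc]

theorem Measurement.trace_kronecker_mul_onBob (M : Measurement 𝕜 κ) (s : ℤˣ)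
    (E : Matrix ι ι 𝕜) (F : Matrix κ κ 𝕜) (ρ : Matrix (ι × κ) (ι × κ) 𝕜) :
    ((E ⊗ₖ F) * M.onBob s ρ).trace = ((E ⊗ₖ M.dual s F) * ρ).trace := by
  simp only [Measurement.onBob, Measurement.dual, Finset.mul_sum, Matrix.trace_sum]
  rw [show E ⊗ₖ (∑ i, (M.kraus s i)ᴴ * F * M.kraus s i) =
      ∑ i, E ⊗ₖ ((M.kraus s i)ᴴ * F * M.kraus s i) by
    ext; simp [Matrix.sum_apply, Finset.mul_sum], Finset.sum_mul, Matrix.trace_sum]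
  refine Finset.sum_congr rfl fun i _ => ?_
  have h : E ⊗ₖ ((M.kraus s i)ᴴ * F * M.kraus s i) =
      ((1 : Matrix ι ι 𝕜) ⊗ₖ M.kraus s i)ᴴ * (E ⊗ₖ F) * ((1 : Matrix ι ι 𝕜) ⊗ₖ M.kraus s i) := by
    rw [Matrix.conjTranspose_kronecker, ← Matrix.mul_kronecker_mul, ← Matrix.mul_kronecker_mul]
    simp
  rw [h, ← mul_assoc, Matrix.trace_mul_comm]
  simp only [mul_assoc]

theorem norm_apply_le_of_posSemidef {E : Matrix ι ι 𝕜} (hE : E.PosSemidef) (i j : ι) :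
    ‖E i j‖ ≤ (RCLike.re (E i i) + RCLike.re (E j j)) / 2 := by
  obtain ⟨B, rfl⟩ : ∃ B : Matrix ι ι 𝕜, E = Bᴴ * B :=
    CStarAlgebra.nonneg_iff_eq_star_mul_self.1 hE.nonneg
  have hd : ∀ i, RCLike.re ((Bᴴ * B) i i) = ∑ k, ‖B k i‖ ^ 2 := by
    intro i
    simp only [Matrix.mul_apply, Matrix.conjTranspose_apply, map_sum]
    refine Finset.sum_congr rfl fun k _ => ?_
    rw [RCLike.star_def, RCLike.conj_mul, ← RCLike.ofReal_pow, RCLike.ofReal_re]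
  rw [hd, hd, ← Finset.sum_add_distrib, Finset.sum_div, Matrix.mul_apply]
  refine (norm_sum_le _ _).trans (Finset.sum_le_sum fun k _ => ?_)
  rw [norm_mul, Matrix.conjTranspose_apply, norm_star]
  nlinarith [sq_nonneg (‖B k i‖ - ‖B k j‖)]

end

/-- A decomposition of the run of a protocol into signed local effects, indexed by the pairs of
a transcript and an output. -/
structure Decomposition {𝕜 : Type*} [RCLike 𝕜] {n a b : ℕ} (P : Protocol 𝕜 n a b) where
  ι : Type
  [fintype : Fintype ι]
  sgn : ι → ℝ
  effA : ι → (Fin n → ℤˣ) → Matrix (Local a) (Local a) 𝕜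
  effB : ι → (Fin n → ℤˣ) → Matrix (Local b) (Local b) 𝕜
  card_le : Fintype.card ι ≤ 2 ^ (P.cost + 1)
  abs_sgn : ∀ t, |sgn t| ≤ 1
  effA_nonneg : ∀ t x, (effA t x).PosSemidef
  effA_le : ∀ t x, (1 - effA t x).PosSemidef
  effB_nonneg : ∀ t y, (effB t y).PosSemidef
  effB_le : ∀ t y, (1 - effB t y).PosSemidef
  sum_trace : ∀ x y ρ, ∑ t, ((effA t x ⊗ₖ effB t y) * ρ).trace = ρ.trace
  run_eq : ∀ x y ρ, P.run x y ρ = ∑ t, sgn t * RCLike.re ((effA t x ⊗ₖ effB t y) * ρ).trace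

attribute [instance] Decomposition.fintype

theorem Measurement.sum_trace_onAlice {𝕜 : Type*} [RCLike 𝕜] {ι κ : Type*} [Fintype ι]
    [DecidableEq ι] [Fintype κ] [DecidableEq κ] (M : Measurement 𝕜 ι)
    (ρ : Matrix (ι × κ) (ι × κ) 𝕜) : ∑ s, (M.onAlice s ρ).trace = ρ.trace := by
  have h : ∀ s, (M.onAlice s ρ).trace = ((M.dual s 1 ⊗ₖ (1 : Matrix κ κ 𝕜)) * ρ).trace := by
    intro s
    rw [← M.trace_kronecker_mul_onAlice, Matrix.one_kronecker_one, one_mul]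
  simp only [h]
  rw [← Matrix.trace_sum, ← Finset.sum_mul, show ∑ s, M.dual s 1 ⊗ₖ (1 : Matrix κ κ 𝕜) =
    (∑ s, M.dual s 1) ⊗ₖ (1 : Matrix κ κ 𝕜) by
      ext; simp only [Matrix.sum_apply, Matrix.kroneckerMap_apply, Finset.sum_mul],
    M.sum_dual_one, Matrix.one_kronecker_one, one_mul]

theorem Measurement.sum_trace_onBob {𝕜 : Type*} [RCLike 𝕜] {ι κ : Type*} [Fintype ι]
    [DecidableEq ι] [Fintype κ] [DecidableEq κ] (M : Measurement 𝕜 κ)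
    (ρ : Matrix (ι × κ) (ι × κ) 𝕜) : ∑ s, (M.onBob s ρ).trace = ρ.trace := by
  have h : ∀ s, (M.onBob s ρ).trace = (((1 : Matrix ι ι 𝕜) ⊗ₖ M.dual s 1) * ρ).trace := by
    intro s
    rw [← M.trace_kronecker_mul_onBob, Matrix.one_kronecker_one, one_mul]
  simp only [h]
  rw [← Matrix.trace_sum, ← Finset.sum_mul, show ∑ s, (1 : Matrix ι ι 𝕜) ⊗ₖ M.dual s 1 =
    (1 : Matrix ι ι 𝕜) ⊗ₖ (∑ s, M.dual s 1) by
      ext; simp only [Matrix.sum_apply, Matrix.kroneckerMap_apply, Finset.mul_sum],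
    M.sum_dual_one, Matrix.one_kronecker_one, one_mul]

theorem card_sigma_le {ι : ℤˣ → Type} [∀ s, Fintype (ι s)] {c : ℤˣ → ℕ}
    (h : ∀ s, Fintype.card (ι s) ≤ 2 ^ (c s + 1)) :
    Fintype.card (Σ s, ι s) ≤ 2 ^ (max (c 1) (c (-1)) + 1 + 1) := by
  rw [Fintype.card_sigma, pow_succ, mul_two, UnitsInt.univ, Finset.sum_pair (by decide)]
  exact add_le_add
    ((h 1).trans (Nat.pow_le_pow_right two_pos (Nat.succ_le_succ (le_max_left _ _))))
    ((h (-1)).trans (Nat.pow_le_pow_right two_pos (Nat.succ_le_succ (le_max_right _ _))))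

theorem nonempty_decomposition {𝕜 : Type*} [RCLike 𝕜] {n a b : ℕ} (P : Protocol 𝕜 n a b) :
    Nonempty (Decomposition P) := by
  induction P with
  | output M =>
    exact ⟨{
      ι := ℤˣ
      sgn := fun s => ((s : ℤ) : ℝ)
      effA := fun s x => (M x).dual s 1
      effB := fun _ _ => 1
      card_le := by simp [Protocol.cost]
      abs_sgn := fun s => by rcases Int.units_eq_one_or s with h | h <;> simp [h]
      effA_nonneg := fun s x => (M x).posSemidef_dual s Matrix.PosSemidef.one
      effA_le := fun s x => (M x).posSemidef_one_sub_dual s (by simpa using Matrix.PosSemidef.zero)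
      effB_nonneg := fun _ _ => Matrix.PosSemidef.one
      effB_le := fun _ _ => by simpa using Matrix.PosSemidef.zero
      sum_trace := fun x y ρ => by
        simp only [← Measurement.trace_kronecker_mul_onAlice, Matrix.one_kronecker_one, one_mul]
        exact (M x).sum_trace_onAlice ρ
      run_eq := fun x y ρ => by
        simp only [← Measurement.trace_kronecker_mul_onAlice, Matrix.one_kronecker_one, one_mul]
        rfl }⟩
  | alice M P ih =>
    have D := fun s => (ih s).some
    exact ⟨{
      ι := Σ s, (D s).ι
      sgn := fun t => (D t.1).sgn t.2
      effA := fun t x => (M x).dual t.1 ((D t.1).effA t.2 x)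
      effB := fun t y => (D t.1).effB t.2 y
      card_le := card_sigma_le fun s => (D s).card_le
      abs_sgn := fun t => (D t.1).abs_sgn t.2
      effA_nonneg := fun t x => (M x).posSemidef_dual t.1 ((D t.1).effA_nonneg t.2 x)
      effA_le := fun t x => (M x).posSemidef_one_sub_dual t.1 ((D t.1).effA_le t.2 x)
      effB_nonneg := fun t y => (D t.1).effB_nonneg t.2 y
      effB_le := fun t y => (D t.1).effB_le t.2 y
      sum_trace := fun x y ρ => by
        simp only [← Measurement.trace_kronecker_mul_onAlice, Fintype.sum_sigma,
          Decomposition.sum_trace]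
        exact (M x).sum_trace_onAlice ρ
      run_eq := fun x y ρ => by
        simp only [← Measurement.trace_kronecker_mul_onAlice, Fintype.sum_sigma,
          ← Decomposition.run_eq]
        rfl }⟩
  | bob M P ih =>
    have D := fun s => (ih s).some
    exact ⟨{
      ι := Σ s, (D s).ι
      sgn := fun t => (D t.1).sgn t.2
      effA := fun t x => (D t.1).effA t.2 x
      effB := fun t y => (M y).dual t.1 ((D t.1).effB t.2 y)
      card_le := card_sigma_le fun s => (D s).card_le
      abs_sgn := fun t => (D t.1).abs_sgn t.2
      effA_nonneg := fun t x => (D t.1).effA_nonneg t.2 x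
      effA_le := fun t x => (D t.1).effA_le t.2 x
      effB_nonneg := fun t y => (M y).posSemidef_dual t.1 ((D t.1).effB_nonneg t.2 y)
      effB_le := fun t y => (M y).posSemidef_one_sub_dual t.1 ((D t.1).effB_le t.2 y)
      sum_trace := fun x y ρ => by
        simp only [← Measurement.trace_kronecker_mul_onBob, Fintype.sum_sigma,
          Decomposition.sum_trace]
        exact (M y).sum_trace_onBob ρ
      run_eq := fun x y ρ => by
        simp only [← Measurement.trace_kronecker_mul_onBob, Fintype.sum_sigma,
          ← Decomposition.run_eq]
        rfl }⟩

theorem eprState_apply (𝕜 : Type*) [RCLike 𝕜] (p q : Fin 2 × Fin 2) :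
    eprState 𝕜 p q = if p.1 = p.2 then if q.1 = q.2 then ((1 / 2 : ℝ) : 𝕜) else 0 else 0 := by
  have h : ((1 / √2 : ℝ) : 𝕜) * ((1 / √2 : ℝ) : 𝕜) = ((1 / 2 : ℝ) : 𝕜) := by
    rw [← RCLike.ofReal_mul, div_mul_div_comm, Real.mul_self_sqrt (by norm_num), one_mul]
  rw [eprState, Matrix.vecMulVec_apply, Pi.star_apply, eprVector, eprVector]
  split_ifs
  · rw [RCLike.star_def, RCLike.conj_ofReal, h]
  all_goals simp

theorem trace_kronecker_mul_initialState {𝕜 : Type*} [RCLike 𝕜] {a b : ℕ}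
    (E : Matrix (Local a) (Local a) 𝕜) (F : Matrix (Local b) (Local b) 𝕜) :
    ((E ⊗ₖ F) * initialState a b (eprState 𝕜)).trace =
      ((1 / 2 : ℝ) : 𝕜) * ∑ e : Fin 2 × Fin 2, E (e.1, 0) (e.2, 0) * F (e.1, 0) (e.2, 0) := by
  simp [Matrix.trace, Matrix.mul_apply, initialState, eprState_apply, zeroState,
    Fintype.sum_prod_type, Matrix.single_apply, ite_and, Finset.sum_add_distrib]
  ring

theorem Decomposition.sum_diag {𝕜 : Type*} [RCLike 𝕜] {n a b : ℕ} {P : Protocol 𝕜 n a b}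
    (D : Decomposition P) (x y : Fin n → ℤˣ) (i : Local a) (j : Local b) :
    ∑ t, D.effA t x i i * D.effB t y j j = 1 := by
  have h := D.sum_trace x y (Matrix.single (i, j) (i, j) 1)
  simpa [Matrix.trace_mul_single] using h

/-! ### The bound for protocols sharing one EPR pair -/

section

variable {𝕜 : Type*} [RCLike 𝕜] {m : ℕ} {E : Matrix (Local m) (Local m) 𝕜}

/-- The expectation of an effect in the maximally mixed state of the shared qubit, the private
memory being in the state `|0…0⟩`. -/
def mixedProb (E : Matrix (Local m) (Local m) 𝕜) : ℝ :=
  (RCLike.re (E (0, 0) (0, 0)) + RCLike.re (E (1, 0) (1, 0))) / 2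

theorem re_diag_nonneg (hE : E.PosSemidef) (i : Local m) : 0 ≤ RCLike.re (E i i) :=
  (RCLike.nonneg_iff.1 hE.diag_nonneg).1

theorem re_diag_le_one (hE : (1 - E).PosSemidef) (i : Local m) : RCLike.re (E i i) ≤ 1 := by
  simpa using re_diag_nonneg hE i

theorem mixedProb_le_one (hE : (1 - E).PosSemidef) : mixedProb E ≤ 1 := by
  have h0 := re_diag_le_one hE (0, 0)
  have h1 := re_diag_le_one hE (1, 0)
  rw [mixedProb]
  linarith

theorem norm_apply_le_mixedProb (hE : E.PosSemidef) (i j : Fin 2) :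
    ‖E (i, 0) (j, 0)‖ / 2 ≤ mixedProb E := by
  have h := norm_apply_le_of_posSemidef hE (i, 0) (j, 0)
  have h0 := re_diag_nonneg hE (0, 0)
  have h1 := re_diag_nonneg hE (1, 0)
  rw [mixedProb]
  fin_cases i <;> fin_cases j <;> simp at h ⊢ <;> linarith

end

theorem Decomposition.sum_mixedProb_mul {𝕜 : Type*} [RCLike 𝕜] {n a b : ℕ}
    {P : Protocol 𝕜 n a b} (D : Decomposition P) (x y : Fin n → ℤˣ) :
    ∑ t, mixedProb (D.effA t x) * mixedProb (D.effB t y) = 1 := by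
  have h : ∀ i j, ∑ t, RCLike.re (D.effA t x i i) * RCLike.re (D.effB t y j j) = 1 := by
    intro i j
    have h1 := congrArg RCLike.re (D.sum_diag x y i j)
    rw [map_sum, RCLike.one_re] at h1
    rw [← h1]
    refine Finset.sum_congr rfl fun t _ => ?_
    rw [← (D.effA_nonneg t x).isHermitian.coe_re_apply_self i, RCLike.re_ofReal_mul,
      RCLike.ofReal_re]
  have e : ∀ t, mixedProb (D.effA t x) * mixedProb (D.effB t y) =
      RCLike.re (D.effA t x (0, 0) (0, 0)) * RCLike.re (D.effB t y (0, 0) (0, 0)) / 4 +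
      RCLike.re (D.effA t x (0, 0) (0, 0)) * RCLike.re (D.effB t y (1, 0) (1, 0)) / 4 +
      RCLike.re (D.effA t x (1, 0) (1, 0)) * RCLike.re (D.effB t y (0, 0) (0, 0)) / 4 +
      RCLike.re (D.effA t x (1, 0) (1, 0)) * RCLike.re (D.effB t y (1, 0) (1, 0)) / 4 := by
    intro t
    simp only [mixedProb]
    ring
  simp only [e, Finset.sum_add_distrib, ← Finset.sum_div, h]
  norm_num

/-- Real or imaginary part. -/
def part {𝕜 : Type*} [RCLike 𝕜] (r : Bool) (z : 𝕜) : ℝ := if r then RCLike.re z else RCLike.im z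

theorem abs_part_le {𝕜 : Type*} [RCLike 𝕜] (r : Bool) (z : 𝕜) : |part r z| ≤ ‖z‖ := by
  cases r
  · exact RCLike.abs_im_le_norm z
  · exact RCLike.abs_re_le_norm z

theorem Decomposition.expectedOutput_eq {𝕜 : Type*} [RCLike 𝕜] {n a b : ℕ}
    {P : Protocol 𝕜 n a b} (D : Decomposition P) (x y : Fin n → ℤˣ) :
    P.expectedOutput x y = ∑ t, ∑ e : (Fin 2 × Fin 2) × Bool,
      (D.sgn t * if e.2 then 2 else -2) *
        (part e.2 (D.effA t x (e.1.1, 0) (e.1.2, 0)) / 2 *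
          (part e.2 (D.effB t y (e.1.1, 0) (e.1.2, 0)) / 2)) := by
  rw [Protocol.expectedOutput, D.run_eq]
  refine Finset.sum_congr rfl fun t _ => ?_
  rw [trace_kronecker_mul_initialState, RCLike.re_ofReal_mul, map_sum]
  simp only [Fintype.sum_prod_type, Fin.sum_univ_two, Fintype.sum_bool, part, RCLike.mul_re,
    if_true, Bool.false_eq_true, if_false]
  ring

theorem levelMass_xorFiber_expectedOutput_le {𝕜 : Type*} [RCLike 𝕜] {n a b c : ℕ} (l : ℕ)
    (P : Protocol 𝕜 n a b) (hP : P.cost ≤ c) :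
    levelMass l (xorFiber P.expectedOutput) ≤
      64 * 4 ^ l * (((c / (l + 1) : ℕ) : ℝ) + 1) ^ l := by
  obtain ⟨D⟩ := nonempty_decomposition P
  set k := c / (l + 1) + 1 with hk
  have hM : (Fintype.card D.ι : ℝ) ≤ (2 ^ (l + 1) : ℝ) ^ (2 * k) := by
    have h1 : c + 1 ≤ (l + 1) * (2 * k) := by
      have := Nat.lt_mul_div_succ c (Nat.succ_pos l)
      have h2 : (l + 1) * (c / (l + 1) + 1) ≤ (l + 1) * (2 * k) :=
        Nat.mul_le_mul_left _ (by omega)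
      exact Nat.succ_le_of_lt (lt_of_lt_of_le this h2)
    rw [← pow_mul]
    exact_mod_cast D.card_le.trans
      (Nat.pow_le_pow_right two_pos ((Nat.succ_le_succ hP).trans h1))
  have key := levelMass_xorFiber_le (C := P.expectedOutput) (s := 2) (l := l) (k := k)
    (D := (2 * k : ℝ) ^ l) (M := 2 ^ (l + 1))
    (fun t (e : (Fin 2 × Fin 2) × Bool) => D.sgn t * if e.2 then 2 else -2)
    (fun t e x => part e.2 (D.effA t x (e.1.1, 0) (e.1.2, 0)) / 2)
    (fun t e y => part e.2 (D.effB t y (e.1.1, 0) (e.1.2, 0)) / 2)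
    (fun t x => mixedProb (D.effA t x)) (fun t y => mixedProb (D.effB t y))
    (Nat.succ_ne_zero _)
    (fun t e => by
      have := D.abs_sgn t
      rw [abs_mul]
      split_ifs <;> norm_num <;> linarith)
    (fun t e x => by
      rw [abs_div, abs_two]
      exact (div_le_div_of_nonneg_right (abs_part_le _ _) zero_le_two).trans
        (norm_apply_le_mixedProb (D.effA_nonneg t x) _ _))
    (fun t e y => by
      rw [abs_div, abs_two]
      exact (div_le_div_of_nonneg_right (abs_part_le _ _) zero_le_two).trans
        (norm_apply_le_mixedProb (D.effB_nonneg t y) _ _))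
    (fun t x => mixedProb_le_one (D.effA_le t x)) (fun t y => mixedProb_le_one (D.effB_le t y))
    D.sum_mixedProb_mul D.expectedOutput_eq rfl (by positivity) hM
  refine key.trans_eq ?_
  rw [show (Fintype.card ((Fin 2 × Fin 2) × Bool) : ℝ) = 8 by norm_num, mul_pow,
    show (4 : ℝ) ^ l = 2 ^ l * 2 ^ l by rw [← mul_pow]; norm_num, hk]
  push_cast
  ring

end R2Star

end

theorem mainTheorem8 (𝕜 : Type*) [RCLike 𝕜] :
    ∃ A : ℝ, ∃ B : ℕ, ∀ (n a b c l : ℕ) (P : R2Star.Protocol 𝕜 n a b), P.cost ≤ c →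
      R2Star.levelMass l (R2Star.xorFiber P.expectedOutput) ≤
        A * 2 ^ (B * l) + A * 2 ^ (B * l) * ((c : ℝ) / (l : ℝ)) ^ l := by
  refine ⟨64, 3, fun n a b c l P hP => ?_⟩
  refine (R2Star.levelMass_xorFiber_expectedOutput_le l P hP).trans ?_
  rcases Nat.eq_zero_or_pos l with rfl | hl
  · norm_num
  have hl' : (0 : ℝ) < l := by exact_mod_cast hl
  have h1 : ((c / (l + 1) : ℕ) : ℝ) ≤ c / l :=
    Nat.cast_div_le.trans (div_le_div_of_nonneg_left (by positivity) hl' (by push_cast; linarith))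
  have h2 : (((c / (l + 1) : ℕ) : ℝ) + 1) ^ l ≤ 2 ^ l * (((c : ℝ) / l) ^ l + 1) :=
    calc (((c / (l + 1) : ℕ) : ℝ) + 1) ^ l ≤ ((c : ℝ) / l + 1) ^ l := by gcongr
      _ ≤ 2 ^ (l - 1) * (((c : ℝ) / l) ^ l + 1 ^ l) := add_pow_le (by positivity) zero_le_one l
      _ ≤ 2 ^ l * (((c : ℝ) / l) ^ l + 1) := by
          rw [one_pow]
          gcongr
          · norm_num
          · omega
  calc 64 * 4 ^ l * (((c / (l + 1) : ℕ) : ℝ) + 1) ^ l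
      ≤ 64 * 4 ^ l * (2 ^ l * (((c : ℝ) / l) ^ l + 1)) := by gcongr
    _ = 64 * (4 * 2) ^ l * (((c : ℝ) / l) ^ l + 1) := by rw [mul_pow]; ring
    _ = _ := by rw [pow_mul, show (4 * 2 : ℝ) = 2 ^ 3 by norm_num]; ring
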